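/- **Conventions.** A dioid is an idempotent semiring, ordered by $a\le b\iff a+b=b$. For a monoid $M$, $\mathcal R M$ denotes the dioid of regular subsets of $M$ (the least class of subsets containing the finite ones and closed under union, elementwise product and $A\mapsto A^*$, the submonoid generated by $A$). An $\mathcal R$-dioid is a dioid $D$ in which every regular subset $A$ of the multiplicative monoid of $D$ has a least upper bound $\sum A$ and $\sum(AB)=(\sum A)(\sum B)$ for regular $A,B$; equivalently, it is a $*$-continuous Kleene algebra with $c^*=\sum\{c\}^*$. An $\mathcal R$-congruence on an $\mathcal R$-dioid $D$ is a semiring congruence $\rho$ such that $(\sum A)/\rho=(\sum A')/\rho$ whenever $A,A'\subseteq D$ are regular and their images in $D/\rho$ have the same downward closure. For $m\ge 1$ let $\Delta_m=\{p_0,\dots,p_{m-1},q_0,\dots,q_{m-1}\}$ be an alphabet of $m$ bracket pairs, and let $C_m'=\mathcal R\Delta_m^*/\rho$ be the polycyclic $\mathcal R$-dioid, where $\rho$ is the least $\mathcal R$-congruence with $p_iq_j=\delta_{i,j}$ for $i,j<m$. For $\mathcal R$-dioids $K,C$ the tensor product is $K\otimes_{\mathcal R}C=\mathcal R(K\times C)/{\equiv}$,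 where $\equiv$ is the least $\mathcal R$-congruence with $A\times B\equiv\{(\sum A,\sum B)\}$ for all $A\in\mathcal RK$, $B\in\mathcal RC$; this is an $\mathcal R$-dioid, and $k\in K$, $c\in C$ are identified with the classes of $\{(k,1)\}$, $\{(1,c)\}$. The square matrices $\mathrm{Mat}_{n,n}(D)$ over an $\mathcal R$-dioid $D$ are ordered by $A\le B\iff A+B=B$, and $A^*$ is the usual iteration of matrices, defined recursively by $$\begin{pmatrix}A&B\\C&E\end{pmatrix}^*=\begin{pmatrix}G^*&G^*BE^*\\E^*CG^*&E^*CG^*BE^*+E^*\end{pmatrix},\qquad G=A+BE^*C.$$ Scalars multiplied with matrices are read as the corresponding diagonal matrices. **Theorem (Second Normal Form).** Let $K$ be an $\mathcal R$-dioid, $m\ge 2$, and let $\phi\in K\otimes_{\mathcal R}C_m'$ be given in matrix form $$\phi=S\,(U+X+V+W\pi)^*\,F,\qquad \pi=q_0p_0,$$ where for some $n\ge 0$: $S\in\{0,1\}^{1\times n}$, $F\in\{0,1\}^{n\times 1}$, $X\in K^{n\times n}$, $W\in\{0,1\}^{n\times n}$, $U\in\{0,p_1,\dots,p_{m-1}\}^{n\times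 n}$ and $V\in\{0,q_1,\dots,q_{m-1}\}^{n\times n}$. Then there is a least solution $N$ of $y\ge (UyV+X)^*$ in $\mathrm{Mat}_{n,n}(K\otimes_{\mathcal R}C_m')$, and $$p_0\,\phi\,q_0=S\,N\,(WN)^*\,F .$$ Moreover $p_0\,\phi\,q_0$ belongs to the centralizer of $C_m'$ in $K\otimes_{\mathcal R}C_m'$, i.e. it commutes with every element of $C_m'$. -/

import Mathlib

open scoped Pointwise

/-- The regular (rational) subsets of a monoid: the least class of subsets that contains the finite
sets and is closed under union, elementwise product and iteration `A ↦ A*`, where `A*` is the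
submonoid generated by `A`. -/
inductive IsRationalSet {M : Type*} [Monoid M] : Set M → Prop
  | empty : IsRationalSet ∅
  | singleton (x : M) : IsRationalSet {x}
  | union {A B : Set M} : IsRationalSet A → IsRationalSet B → IsRationalSet (A ∪ B)
  | mul {A B : Set M} : IsRationalSet A → IsRationalSet B → IsRationalSet (A * B)
  | star {A : Set M} : IsRationalSet A → IsRationalSet (Submonoid.closure A : Set M)

theorem IsRationalSet.image {M N : Type*} [Monoid M] [Monoid N] (f : M →* N) {A : Set M}
    (hA : IsRationalSet A) : IsRationalSet (f '' A) := by
  induction hA with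
  | empty => rw [Set.image_empty]; exact .empty
  | singleton x => rw [Set.image_singleton]; exact .singleton _
  | union _ _ h1 h2 => rw [Set.image_union]; exact .union h1 h2
  | mul _ _ h1 h2 => rw [Set.image_mul]; exact .mul h1 h2
  | star _ h =>
    rw [← Submonoid.coe_map, MonoidHom.map_mclosure]; exact .star h

theorem IsRationalSet.prod {M N : Type*} [Monoid M] [Monoid N] {A : Set M} {B : Set N}
    (hA : IsRationalSet A) (hB : IsRationalSet B) : IsRationalSet (A ×ˢ B) := by
  have h := (hA.image (MonoidHom.inl M N)).mul (hB.image (MonoidHom.inr M N))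
  have e : (MonoidHom.inl M N '' A) * (MonoidHom.inr M N '' B) = A ×ˢ B := by
    ext ⟨x, y⟩
    simp [Set.mem_mul]
  rwa [e] at h

/-- Every regular subset of a quotient is the image of a regular subset. -/
theorem IsRationalSet.exists_image_eq {M N : Type*} [Monoid M] [Monoid N] (f : M →* N)
    (hf : Function.Surjective f) {B : Set N} (hB : IsRationalSet B) :
    ∃ A : Set M, IsRationalSet A ∧ f '' A = B := by
  induction hB with
  | empty => exact ⟨∅, .empty, Set.image_empty _⟩
  | singleton y =>
    obtain ⟨x, rfl⟩ := hf y
    exact ⟨{x}, .singleton x, Set.image_singleton⟩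
  | union _ _ h1 h2 =>
    obtain ⟨A, hA, rfl⟩ := h1
    obtain ⟨A', hA', rfl⟩ := h2
    exact ⟨A ∪ A', hA.union hA', Set.image_union _ _ _⟩
  | mul _ _ h1 h2 =>
    obtain ⟨A, hA, rfl⟩ := h1
    obtain ⟨A', hA', rfl⟩ := h2
    exact ⟨A * A', hA.mul hA', Set.image_mul f⟩
  | star _ h =>
    obtain ⟨A, hA, rfl⟩ := h
    exact ⟨_, hA.star, by rw [← Submonoid.coe_map, MonoidHom.map_mclosure]⟩

/-- An `ℛ`-dioid: a dioid (idempotent semiring, with its natural order `a ≤ b ↔ a + b = b`) in which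
every regular subset `A` of the multiplicative monoid has a least upper bound `∑ A`, and
`∑ (A * B) = (∑ A) * (∑ B)` for regular `A`, `B`. -/
class RDioid (D : Type*) [IdemSemiring D] : Prop where
  exists_isLUB : ∀ A : Set D, IsRationalSet A → ∃ a, IsLUB A a
  isLUB_mul : ∀ A B : Set D, IsRationalSet A → IsRationalSet B →
    ∀ a b : D, IsLUB A a → IsLUB B b → IsLUB (A * B) (a * b)

/-- Iteration in an `ℛ`-dioid: `c* = ∑ {c}*`, the least upper bound of all powers of `c`. -/
noncomputable def RDioid.star {D : Type*} [IdemSemiring D] [RDioid D] (c : D) : D :=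
  Classical.choose (RDioid.exists_isLUB (Submonoid.closure {c} : Set D)
    (IsRationalSet.star (IsRationalSet.singleton c)))

theorem RDioid.isLUB_star {D : Type*} [IdemSemiring D] [RDioid D] (c : D) :
    IsLUB (Submonoid.closure {c} : Set D) (RDioid.star c) :=
  Classical.choose_spec (RDioid.exists_isLUB (Submonoid.closure {c} : Set D)
    (IsRationalSet.star (IsRationalSet.singleton c)))

/-- The type `ℛ M` of regular subsets of a monoid `M`. -/
def RatSet (M : Type*) [Monoid M] : Type _ := {A : Set M // IsRationalSet A}

namespace RatSet

variable {M : Type*} [Monoid M]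

/-- The singleton `{x}` as a regular set. -/
def single (x : M) : RatSet M := ⟨{x}, .singleton x⟩

/-- `ℛ M` is a dioid: sum is union, product is elementwise product, and the order is inclusion. -/
instance : IdemSemiring (RatSet M) where
  add A B := ⟨A.1 ∪ B.1, A.2.union B.2⟩
  add_assoc A B C := Subtype.ext (Set.union_assoc _ _ _)
  zero := ⟨∅, .empty⟩
  zero_add A := Subtype.ext (Set.empty_union _)
  add_zero A := Subtype.ext (Set.union_empty _)
  add_comm A B := Subtype.ext (Set.union_comm _ _)
  mul A B := ⟨A.1 * B.1, A.2.mul B.2⟩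
  left_distrib A B C := Subtype.ext Set.mul_union
  right_distrib A B C := Subtype.ext Set.union_mul
  zero_mul A := Subtype.ext Set.empty_mul
  mul_zero A := Subtype.ext Set.mul_empty
  mul_assoc A B C := Subtype.ext (mul_assoc A.1 B.1 C.1)
  one := ⟨{1}, .singleton 1⟩
  one_mul A := Subtype.ext (one_mul A.1)
  mul_one A := Subtype.ext (mul_one A.1)
  le A B := A.1 ⊆ B.1
  le_refl A := Set.Subset.refl _
  le_trans A B C h h' := Set.Subset.trans h h'
  le_antisymm A B h h' := Subtype.ext (Set.Subset.antisymm h h')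
  sup A B := ⟨A.1 ∪ B.1, A.2.union B.2⟩
  le_sup_left A B := Set.subset_union_left
  le_sup_right A B := Set.subset_union_right
  sup_le A B C h h' := Set.union_subset h h'
  bot := ⟨∅, .empty⟩
  bot_le A := Set.empty_subset _
  add_eq_sup A B := rfl
  nsmul := @nsmulRec _ ⟨⟨∅, .empty⟩⟩ ⟨fun A B => ⟨A.1 ∪ B.1, A.2.union B.2⟩⟩

theorem coe_mul (A B : RatSet M) : (A * B).1 = A.1 * B.1 := rfl

theorem coe_one : (1 : RatSet M).1 = {1} := rfl

/-- The union of a regular set of regular sets is regular. -/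
theorem isRationalSet_biUnion {U : Set (RatSet M)} (hU : IsRationalSet U) :
    IsRationalSet (⋃ A ∈ U, A.1) := by
  induction hU with
  | empty => simpa using IsRationalSet.empty
  | singleton A => simpa using A.2
  | union _ _ h1 h2 => rw [Set.biUnion_union]; exact h1.union h2
  | @mul U V _ _ h1 h2 =>
    have e : (⋃ A ∈ U * V, A.1) = (⋃ A ∈ U, A.1) * (⋃ A ∈ V, A.1) := by
      ext x
      simp only [Set.mem_iUnion, Set.mem_mul, exists_prop]
      constructor
      · rintro ⟨_, ⟨A, hA, B, hB, rfl⟩, a, ha, b, hb, rfl⟩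
        exact ⟨a, ⟨A, hA, ha⟩, b, ⟨B, hB, hb⟩, rfl⟩
      · rintro ⟨a, ⟨A, hA, ha⟩, b, ⟨B, hB, hb⟩, rfl⟩
        exact ⟨A * B, ⟨A, hA, B, hB, rfl⟩, a, ha, b, hb, rfl⟩
    rw [e]; exact h1.mul h2
  | @star U _ h =>
    have e : (⋃ A ∈ (Submonoid.closure U : Set (RatSet M)), A.1)
        = (Submonoid.closure (⋃ A ∈ U, A.1) : Set M) := by
      apply Set.Subset.antisymm
      · refine Set.iUnion₂_subset fun A hA => ?_
        induction hA using Submonoid.closure_induction with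
        | mem A hA => exact (Set.subset_biUnion_of_mem hA).trans Submonoid.subset_closure
        | one =>
          rw [coe_one, Set.singleton_subset_iff]
          exact Submonoid.one_mem _
        | mul A B _ _ h1 h2 =>
          rw [coe_mul]
          rintro _ ⟨a, ha, b, hb, rfl⟩
          exact Submonoid.mul_mem _ (h1 ha) (h2 hb)
      · intro x hx
        simp only [Set.mem_iUnion, exists_prop, SetLike.mem_coe] at hx ⊢
        induction hx using Submonoid.closure_induction with
        | mem x hx =>
          simp only [Set.mem_iUnion, exists_prop] at hx
          obtain ⟨A, hA, hx⟩ := hx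
          exact ⟨A, Submonoid.subset_closure hA, hx⟩
        | one => exact ⟨1, Submonoid.one_mem _, rfl⟩
        | mul x y _ _ h1 h2 =>
          obtain ⟨A, hA, hx⟩ := h1
          obtain ⟨B, hB, hy⟩ := h2
          exact ⟨A * B, Submonoid.mul_mem _ hA hB, x, hx, y, hy, rfl⟩
    rw [e]; exact h.star

/-- Least upper bounds of regular subsets of `ℛ M` are unions. -/
theorem isLUB_iff {U : Set (RatSet M)} (hU : IsRationalSet U) (S : RatSet M) :
    IsLUB U S ↔ S.1 = ⋃ A ∈ U, A.1 := by
  have key : IsLUB U (⟨_, isRationalSet_biUnion hU⟩ : RatSet M) :=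
    ⟨fun A hA => Set.subset_biUnion_of_mem (u := fun A : RatSet M => A.1) hA,
      fun B hB => Set.iUnion₂_subset fun A hA => hB hA⟩
  exact ⟨fun h => congrArg Subtype.val (h.unique key), fun h => by
    have e : S = ⟨_, isRationalSet_biUnion hU⟩ := Subtype.ext h
    rw [e]; exact key⟩

instance : RDioid (RatSet M) where
  exists_isLUB U hU := ⟨⟨_, isRationalSet_biUnion hU⟩, (isLUB_iff hU _).2 rfl⟩
  isLUB_mul U V hU hV S T hS hT := by
    rw [isLUB_iff hU] at hS
    rw [isLUB_iff hV] at hT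
    rw [isLUB_iff (hU.mul hV), coe_mul, hS, hT]
    ext x
    simp only [Set.mem_iUnion, Set.mem_mul, exists_prop]
    constructor
    · rintro ⟨a, ⟨A, hA, ha⟩, b, ⟨B, hB, hb⟩, rfl⟩
      exact ⟨A * B, ⟨A, hA, B, hB, rfl⟩, a, ha, b, hb, rfl⟩
    · rintro ⟨_, ⟨A, hA, B, hB, rfl⟩, a, ha, b, hb, rfl⟩
      exact ⟨a, ⟨A, hA, ha⟩, b, ⟨B, hB, hb⟩, rfl⟩

end RatSet

/-- The quotient of a dioid by a semiring congruence is a dioid, with its natural order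
`a ≤ b ↔ a + b = b`. -/
instance RingCon.Quotient.idemSemiring {D : Type*} [IdemSemiring D] (ρ : RingCon D) :
    IdemSemiring ρ.Quotient :=
  IdemSemiring.ofSemiring fun a => by
    induction a using Quotient.inductionOn' with
    | h a => exact congrArg ρ.mk' (add_idem a)

/-- `ℛ`-congruences: semiring congruences `ρ` such that regular sets `U`, `U'` whose images in the
quotient generate the same lower set have congruent least upper bounds. -/
def IsRCongruence {D : Type*} [IdemSemiring D] (ρ : RingCon D) : Prop :=
  ∀ U U' : Set D, IsRationalSet U → IsRationalSet U' →
    lowerClosure (ρ.mk' '' U) = lowerClosure (ρ.mk' '' U') →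
      ∀ s s' : D, IsLUB U s → IsLUB U' s' → ρ s s'

/-- The `ℛ`-congruence generated by a relation: the intersection of all `ℛ`-congruences that
contain it. -/
def rconGen {D : Type*} [IdemSemiring D] (r : D → D → Prop) : RingCon D :=
  sInf {ρ | IsRCongruence ρ ∧ ∀ x y, r x y → ρ x y}

section RCongruence

variable {D : Type*} [IdemSemiring D]

theorem RingCon.mk'_le_iff (ρ : RingCon D) (a b : D) : ρ.mk' a ≤ ρ.mk' b ↔ ρ (a + b) b := by
  rw [← add_eq_right_iff_le, ← map_add]
  exact ρ.eq

theorem RingCon.lowerClosure_le_iff (ρ : RingCon D) (U U' : Set D) :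
    lowerClosure (ρ.mk' '' U) ≤ lowerClosure (ρ.mk' '' U') ↔
      ∀ u ∈ U, ∃ u' ∈ U', ρ (u + u') u' := by
  rw [lowerClosure_le]
  constructor
  · intro h u hu
    obtain ⟨_, ⟨u', hu', rfl⟩, hle⟩ := h ⟨u, hu, rfl⟩
    exact ⟨u', hu', (ρ.mk'_le_iff _ _).1 hle⟩
  · rintro h _ ⟨u, hu, rfl⟩
    obtain ⟨u', hu', hle⟩ := h u hu
    exact ⟨_, ⟨u', hu', rfl⟩, (ρ.mk'_le_iff _ _).2 hle⟩

theorem rconGen_iff {r : D → D → Prop} {x y : D} : rconGen r x y ↔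
    ∀ ρ : RingCon D, (IsRCongruence ρ ∧ ∀ x y, r x y → ρ x y) → ρ x y :=
  Iff.rfl

theorem rconGen_of {r : D → D → Prop} {x y : D} (h : r x y) : rconGen r x y :=
  rconGen_iff.2 fun _ hρ => hρ.2 _ _ h

theorem rconGen_le {r : D → D → Prop} {ρ : RingCon D} (hρ : IsRCongruence ρ)
    (h : ∀ x y, r x y → ρ x y) : rconGen r ≤ ρ :=
  sInf_le ⟨hρ, h⟩

theorem isRCongruence_rconGen (r : D → D → Prop) : IsRCongruence (rconGen r) := by
  intro U U' hU hU' h s s' hs hs'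
  refine rconGen_iff.2 fun ρ hρ => ?_
  have mono : ∀ V V' : Set D, lowerClosure ((rconGen r).mk' '' V) ≤
      lowerClosure ((rconGen r).mk' '' V') →
        lowerClosure (ρ.mk' '' V) ≤ lowerClosure (ρ.mk' '' V') := by
    intro V V' hV
    rw [RingCon.lowerClosure_le_iff] at hV ⊢
    intro u hu
    obtain ⟨u', hu', h1⟩ := hV u hu
    exact ⟨u', hu', rconGen_iff.1 h1 ρ hρ⟩
  exact hρ.1 U U' hU hU' (le_antisymm (mono _ _ h.le) (mono _ _ h.ge)) s s' hs hs'

/-- In the quotient by an `ℛ`-congruence, the class of the least upper bound of a regular set is the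
least upper bound of the classes. -/
theorem IsRCongruence.isLUB_image {ρ : RingCon D} (hρ : IsRCongruence ρ) {U : Set D}
    (hU : IsRationalSet U) {s : D} (hs : IsLUB U s) : IsLUB (ρ.mk' '' U) (ρ.mk' s) := by
  constructor
  · rintro _ ⟨u, hu, rfl⟩
    rw [← add_eq_right_iff_le, ← map_add, add_eq_right_iff_le.2 (hs.1 hu)]
  · intro x hx
    obtain ⟨d, rfl⟩ := ρ.mk'_surjective x
    rw [RingCon.mk'_le_iff]
    refine hρ (U ∪ {d}) {d} (hU.union (.singleton d)) (.singleton d) (le_antisymm ?_ ?_) _ _ ?_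
      isLUB_singleton
    · rw [RingCon.lowerClosure_le_iff]
      rintro u (hu | rfl)
      · exact ⟨d, rfl, (ρ.mk'_le_iff _ _).1 (hx ⟨u, hu, rfl⟩)⟩
      · exact ⟨u, rfl, by rw [add_idem]; exact ρ.refl u⟩
    · exact lowerClosure_mono (Set.image_mono Set.subset_union_right)
    · rw [add_eq_sup]
      exact hs.union isLUB_singleton

/-- The quotient of an `ℛ`-dioid by a generated `ℛ`-congruence is an `ℛ`-dioid. -/
instance rconGen.instRDioid [RDioid D] (r : D → D → Prop) : RDioid (rconGen r).Quotient where
  exists_isLUB A hA := by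
    obtain ⟨A, hA', rfl⟩ :=
      hA.exists_image_eq (rconGen r).mk'.toMonoidHom (rconGen r).mk'_surjective
    obtain ⟨a, ha⟩ := RDioid.exists_isLUB A hA'
    exact ⟨_, (isRCongruence_rconGen r).isLUB_image hA' ha⟩
  isLUB_mul A B hA hB x y hx hy := by
    obtain ⟨A, hA', rfl⟩ :=
      hA.exists_image_eq (rconGen r).mk'.toMonoidHom (rconGen r).mk'_surjective
    obtain ⟨B, hB', rfl⟩ :=
      hB.exists_image_eq (rconGen r).mk'.toMonoidHom (rconGen r).mk'_surjective
    obtain ⟨a, ha⟩ := RDioid.exists_isLUB A hA'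
    obtain ⟨b, hb⟩ := RDioid.exists_isLUB B hB'
    have hρ := isRCongruence_rconGen r
    rw [hx.unique (hρ.isLUB_image hA' ha), hy.unique (hρ.isLUB_image hB' hb), ← map_mul,
      ← Set.image_mul]
    exact hρ.isLUB_image (hA'.mul hB') (RDioid.isLUB_mul A B hA' hB' a b ha hb)

end RCongruence

/-- The alphabet `Δ_m` of `m` opening and `m` closing brackets. -/
inductive BracketSym (m : ℕ) : Type
  | op (i : Fin m) : BracketSym m
  | cl (i : Fin m) : BracketSym m

/-- The bracket equations `{p_i} {q_i} = 1` and `{p_i} {q_j} = 0` for `i ≠ j`. -/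
inductive BracketRel (m : ℕ) :
    RatSet (FreeMonoid (BracketSym m)) → RatSet (FreeMonoid (BracketSym m)) → Prop
  | same (i : Fin m) : BracketRel m
      (RatSet.single (FreeMonoid.of (.op i)) * RatSet.single (FreeMonoid.of (.cl i))) 1
  | diff (i j : Fin m) (h : i ≠ j) : BracketRel m
      (RatSet.single (FreeMonoid.of (.op i)) * RatSet.single (FreeMonoid.of (.cl j))) 0

/-- The polycyclic `ℛ`-dioid `C_m' = ℛ Δ_m* / ρ`, where `ρ` is the `ℛ`-congruence generated by the
bracket equations. -/
abbrev Polycyclic (m : ℕ) : Type := (rconGen (BracketRel m)).Quotient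

namespace Polycyclic

variable {m : ℕ}

/-- The opening bracket `p_i` in `C_m'`. -/
def p (i : Fin m) : Polycyclic m :=
  (rconGen (BracketRel m)).mk' (RatSet.single (FreeMonoid.of (.op i)))

/-- The closing bracket `q_i` in `C_m'`. -/
def q (i : Fin m) : Polycyclic m :=
  (rconGen (BracketRel m)).mk' (RatSet.single (FreeMonoid.of (.cl i)))

end Polycyclic

/-- The tensor product equations `A × B = {(∑ A, ∑ B)}` for regular `A`, `B`. -/
inductive TensorRel (K C : Type*) [IdemSemiring K] [IdemSemiring C] :
    RatSet (K × C) → RatSet (K × C) → Prop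
  | mk (A : Set K) (B : Set C) (hA : IsRationalSet A) (hB : IsRationalSet B) (a : K) (b : C)
      (ha : IsLUB A a) (hb : IsLUB B b) :
      TensorRel K C ⟨A ×ˢ B, hA.prod hB⟩ (RatSet.single (a, b))

/-- The tensor product `K ⊗_ℛ C = ℛ (K × C) / ≡` of `ℛ`-dioids, where `≡` is the `ℛ`-congruence
generated by the tensor product equations. -/
abbrev RTensor (K C : Type*) [IdemSemiring K] [IdemSemiring C] : Type _ :=
  (rconGen (TensorRel K C)).Quotient

namespace RTensor

variable {K C : Type*} [IdemSemiring K] [IdemSemiring C]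

/-- The canonical map `K → K ⊗_ℛ C`, `a ↦ [{(a, 1)}]`. -/
def inl (a : K) : RTensor K C := (rconGen (TensorRel K C)).mk' (RatSet.single (a, 1))

/-- The canonical map `C → K ⊗_ℛ C`, `b ↦ [{(1, b)}]`. -/
def inr (b : C) : RTensor K C := (rconGen (TensorRel K C)).mk' (RatSet.single (1, b))

end RTensor

/-- Square matrices over a dioid form a dioid, with its natural order `A ≤ B ↔ A + B = B`. -/
instance Matrix.instIdemSemiringFin {D : Type*} [IdemSemiring D] (n : ℕ) :
    IdemSemiring (Matrix (Fin n) (Fin n) D) :=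
  IdemSemiring.ofSemiring fun A => Matrix.ext fun i j => add_idem (A i j)

/-- Iteration of square matrices over an `ℛ`-dioid, by the recursion
`(a b; c E)* = (f*, f* b E*; E* c f*, E* c f* b E* + E*)` with `f = a + b E* c`, where `a` is the
upper left entry. -/
noncomputable def matStar {D : Type*} [IdemSemiring D] [RDioid D] :
    {n : ℕ} → Matrix (Fin n) (Fin n) D → Matrix (Fin n) (Fin n) D
  | 0, _ => 1
  | n + 1, M =>
    let b : Fin n → D := fun j => M 0 j.succ
    let c : Fin n → D := fun i => M i.succ 0
    let E : Matrix (Fin n) (Fin n) D := matStar (M.submatrix Fin.succ Fin.succ)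
    let g : D := RDioid.star (M 0 0 + b ⬝ᵥ E.mulVec c)
    Matrix.of (Fin.cons
      (Fin.cons g fun j => g * E.vecMul b j : Fin (n + 1) → D)
      fun i => Fin.cons (E.mulVec c i * g) fun j => E.mulVec c i * g * E.vecMul b j + E i j)

/-! Put `A = (U + X + V)∗` and `N = p₀ A q₀`. In a power of `U + X + V`, balanced bracket segments
evaluate to elements commuting with `C_m'`, since `p_i z q_j = z p_i q_j` is `z` or `0` for such
`z`. Hence every power lies below some `(B V)∗ B (U B)∗`, where `B` is built by finitely many sums
and products and has entries in the centralizer (`pow_le_bracketApprox`). Multiplying by `p₀` on the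
left and `q₀` on the right removes the unmatched brackets, because `p₀ V = 0 = U q₀`, and leaves `p₀
B q₀ = B` (`mul_pow_mul_le_bracketApprox`).

Entrywise *-continuity of the matrix star (`matStar_apply_le`) passes from powers to `A`. So `N` is
the least upper bound of the finite approximations, its entries lie in the centralizer, and it is
the least solution. The formula for `p₀ φ q₀` is then Kleene algebra of matrices: denesting turns
`(U + X + V + W q₀ p₀)∗` into `A (W q₀ p₀ A)∗`, and sliding `q₀` through the star gives `p₀ A q₀ (W
p₀ A q₀)∗ = N (W N)∗`. -/

/-! ### Entrywise order and products of matrices. -/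

theorem Matrix.le_iff_apply {D : Type*} [IdemSemiring D] {n : ℕ}
    {A B : Matrix (Fin n) (Fin n) D} : A ≤ B ↔ ∀ i j, A i j ≤ B i j := by
  rw [← add_eq_right_iff_le, ← Matrix.ext_iff]
  exact forall₂_congr fun i j => add_eq_right_iff_le

theorem Finset.sum_le_of_forall_le {D ι : Type*} [IdemSemiring D] {s : Finset ι} {f : ι → D}
    {z : D} (h : ∀ i ∈ s, f i ≤ z) : ∑ i ∈ s, f i ≤ z := by
  classical
  induction s using Finset.induction_on with
  | empty => rw [Finset.sum_empty]; exact zero_le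
  | insert a s ha ih =>
    rw [Finset.sum_insert ha]
    exact add_le (h _ (Finset.mem_insert_self _ _))
      (ih fun i hi => h i (Finset.mem_insert_of_mem hi))

theorem Matrix.mul_apply_le_iff {D : Type*} [IdemSemiring D] {n : ℕ}
    {A B : Matrix (Fin n) (Fin n) D} {i j : Fin n} {z : D} :
    (A * B) i j ≤ z ↔ ∀ l, A i l * B l j ≤ z := by
  rw [Matrix.mul_apply]
  exact ⟨fun h l => (Finset.single_le_sum_of_canonicallyOrdered
    (f := fun l => A i l * B l j) (Finset.mem_univ l)).trans h,
    fun h => Finset.sum_le_of_forall_le fun l _ => h l⟩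

theorem Matrix.mul_le_mul_apply {D : Type*} [IdemSemiring D] {n : ℕ}
    (A B : Matrix (Fin n) (Fin n) D) (i l j : Fin n) : A i l * B l j ≤ (A * B) i j :=
  Matrix.mul_apply_le_iff.1 le_rfl l

/-! ### *-continuity of the matrix star. -/

section StarContinuity

variable {D : Type*} [IdemSemiring D]

/-- `x` lies below every upper bound of `A`, and this persists under left and right
multiplication. -/
def IsCovered (A : Set D) (x : D) : Prop :=
  ∀ a b z : D, (∀ s ∈ A, a * s * b ≤ z) → a * x * b ≤ z

theorem IsCovered.of_mem {A : Set D} {x : D} (h : x ∈ A) : IsCovered A x :=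
  fun _ _ _ hz => hz x h

theorem IsCovered.add {A : Set D} {x y : D} (hx : IsCovered A x) (hy : IsCovered A y) :
    IsCovered A (x + y) := fun a b z hz => by
  rw [mul_add, add_mul]
  exact add_le (hx a b z hz) (hy a b z hz)

theorem IsCovered.sum {ι : Type*} {s : Finset ι} {A : Set D} {f : ι → D}
    (h : ∀ i ∈ s, IsCovered A (f i)) : IsCovered A (∑ i ∈ s, f i) := fun a b z hz => by
  rw [Finset.mul_sum, Finset.sum_mul]
  exact Finset.sum_le_of_forall_le fun i hi => h i hi a b z hz

theorem IsCovered.mul {A B C : Set D} {x y : D} (hx : IsCovered A x) (hy : IsCovered B y)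
    (h : ∀ s ∈ A, ∀ t ∈ B, s * t ∈ C) : IsCovered C (x * y) := fun a b z hz => by
  have h1 := hx a (y * b) z fun s hs => by
    have h2 := hy (a * s) b z fun t ht => by
      simpa only [mul_assoc] using hz (s * t) (h s hs t ht)
    simpa only [mul_assoc] using h2
  simpa only [mul_assoc] using h1

/-- Since `∑` is multiplicative on regular sets, `a * x∗ * b` is the least upper bound of the
elements `a * xᵏ * b`. Each power of `x` is covered because `A` is a submonoid. -/
theorem IsCovered.star [RDioid D] {A : Set D} {x : D} (hx : IsCovered A x) (h1 : 1 ∈ A)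
    (hmul : ∀ s ∈ A, ∀ t ∈ A, s * t ∈ A) : IsCovered A (RDioid.star x) := by
  have hc : ∀ y ∈ Submonoid.closure {x}, IsCovered A y := fun y hy => by
    induction hy using Submonoid.closure_induction with
    | mem y hy => rwa [Set.mem_singleton_iff.1 hy]
    | one => exact .of_mem h1
    | mul y y' _ _ hy hy' => exact hy.mul hy' hmul
  intro a b z hz
  have hr := IsRationalSet.star (IsRationalSet.singleton x)
  have hl := RDioid.isLUB_mul _ _ ((IsRationalSet.singleton a).mul hr) (.singleton b) _ _
    (RDioid.isLUB_mul _ _ (.singleton a) hr _ _ isLUB_singleton (RDioid.isLUB_star x))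
    isLUB_singleton
  refine hl.2 ?_
  rintro _ ⟨_, ⟨_, rfl, y, hy, rfl⟩, _, rfl, rfl⟩
  exact hc y hy _ _ z hz

theorem RDioid.one_add_mul_star_le [RDioid D] (c : D) :
    1 + c * RDioid.star c ≤ RDioid.star c := by
  have h := RDioid.isLUB_star c
  refine add_le (h.1 (Submonoid.one_mem _)) ?_
  refine (RDioid.isLUB_mul _ _ (.singleton c) (.star (.singleton c)) _ _ isLUB_singleton h).2 ?_
  rintro _ ⟨_, rfl, y, hy, rfl⟩
  exact h.1 (Submonoid.mul_mem _ (Submonoid.subset_closure rfl) hy)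

/-- The elements that lie below an entry of some power of a matrix. -/
def Matrix.belowPow {n : ℕ} (M : Matrix (Fin n) (Fin n) D) (i j : Fin n) : Set D :=
  {d | ∃ k : ℕ, d ≤ (M ^ k) i j}

theorem Matrix.mul_mem_belowPow {n : ℕ} {M : Matrix (Fin n) (Fin n) D} {i l j : Fin n} {s t : D}
    (hs : s ∈ M.belowPow i l) (ht : t ∈ M.belowPow l j) : s * t ∈ M.belowPow i j := by
  obtain ⟨k, hk⟩ := hs
  obtain ⟨k', hk'⟩ := ht
  refine ⟨k + k', ?_⟩
  rw [pow_add]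
  exact (mul_le_mul' hk hk').trans (Matrix.mul_le_mul_apply _ _ _ _ _)

theorem Matrix.apply_mem_belowPow {n : ℕ} (M : Matrix (Fin n) (Fin n) D) (i j : Fin n) :
    M i j ∈ M.belowPow i j := ⟨1, by rw [pow_one]⟩

theorem Matrix.one_mem_belowPow {n : ℕ} (M : Matrix (Fin n) (Fin n) D) (i : Fin n) :
    (1 : D) ∈ M.belowPow i i := ⟨0, by rw [pow_zero, Matrix.one_apply_eq]⟩

theorem Matrix.pow_submatrix_succ_le {n : ℕ} (M : Matrix (Fin (n + 1)) (Fin (n + 1)) D) (k : ℕ)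
    (i j : Fin n) :
    ((M.submatrix Fin.succ Fin.succ) ^ k) i j ≤ (M ^ k) i.succ j.succ := by
  induction k generalizing i j with
  | zero => simp [Matrix.one_apply]
  | succ k ih =>
    rw [pow_succ, pow_succ, Matrix.mul_apply_le_iff]
    intro l
    exact (mul_le_mul' (ih i l) le_rfl).trans (Matrix.mul_le_mul_apply _ M _ l.succ _)

variable [RDioid D]

/-- The recursion builds each entry from sums, products and one scalar star, and these preserve
coverage because paths concatenate. Paths avoiding the index `0`, counted by the block `E`, are
among the paths of `M`. -/
theorem isCovered_matStar {n : ℕ} (M : Matrix (Fin n) (Fin n) D) (i j : Fin n) :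
    IsCovered (M.belowPow i j) (matStar M i j) := by
  induction n with
  | zero => exact i.elim0
  | succ n ih =>
    have hE : ∀ i j : Fin n, IsCovered (M.belowPow i.succ j.succ)
        (matStar (M.submatrix Fin.succ Fin.succ) i j) := fun i j a b z hz =>
      ih _ i j a b z fun s ⟨k, hk⟩ => hz s ⟨k, hk.trans (M.pow_submatrix_succ_le k i j)⟩
    have hb : ∀ j : Fin n, IsCovered (M.belowPow 0 j.succ)
        ((matStar (M.submatrix Fin.succ Fin.succ)).vecMul (fun j => M 0 j.succ) j) :=
      fun j => IsCovered.sum (s := Finset.univ) fun l _ =>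
        (IsCovered.of_mem (M.apply_mem_belowPow 0 l.succ)).mul (hE l j)
          fun _ hs _ ht => Matrix.mul_mem_belowPow hs ht
    have hc : ∀ i : Fin n, IsCovered (M.belowPow i.succ 0)
        ((matStar (M.submatrix Fin.succ Fin.succ)).mulVec (fun i => M i.succ 0) i) :=
      fun i => IsCovered.sum (s := Finset.univ) fun l _ =>
        (hE i l).mul (IsCovered.of_mem (M.apply_mem_belowPow l.succ 0))
          fun _ hs _ ht => Matrix.mul_mem_belowPow hs ht
    have hg : IsCovered (M.belowPow 0 0) (RDioid.star (M 0 0 + (fun j => M 0 j.succ) ⬝ᵥ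
        (matStar (M.submatrix Fin.succ Fin.succ)).mulVec (fun i => M i.succ 0))) := by
      refine IsCovered.star (.add (.of_mem (M.apply_mem_belowPow 0 0)) (.sum fun l _ => ?_))
        (M.one_mem_belowPow 0) fun _ hs _ ht => Matrix.mul_mem_belowPow hs ht
      exact (IsCovered.of_mem (M.apply_mem_belowPow 0 l.succ)).mul (hc l)
        fun _ hs _ ht => Matrix.mul_mem_belowPow hs ht
    have hcg : ∀ i : Fin n, IsCovered (M.belowPow i.succ 0) _ := fun i =>
      (hc i).mul hg fun _ hs _ ht => Matrix.mul_mem_belowPow hs ht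
    refine Fin.cases ?_ (fun i => ?_) i <;> refine Fin.cases ?_ (fun j => ?_) j
    · exact hg
    · exact hg.mul (hb j) fun _ hs _ ht => Matrix.mul_mem_belowPow hs ht
    · exact hcg i
    · exact ((hcg i).mul (hb j) fun _ hs _ ht => Matrix.mul_mem_belowPow hs ht).add (hE i j)

/-- The outer factors `a` and `b` matter: they will carry row and column entries in the Kleene
axioms, then `p₀`, `q₀` and arbitrary elements of `C_m'`. -/
theorem matStar_apply_le {n : ℕ} {M : Matrix (Fin n) (Fin n) D} {i j : Fin n} {a b z : D}
    (h : ∀ k : ℕ, a * (M ^ k) i j * b ≤ z) : a * matStar M i j * b ≤ z :=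
  isCovered_matStar M i j a b z fun _ ⟨k, hk⟩ =>
    (mul_le_mul' (mul_le_mul' le_rfl hk) le_rfl).trans (h k)

theorem one_add_mul_matStar_le {n : ℕ} (M : Matrix (Fin n) (Fin n) D) :
    1 + M * matStar M ≤ matStar M := by
  induction n with
  | zero => exact Matrix.le_iff_apply.2 fun i => i.elim0
  | succ n ih =>
    set b : Fin n → D := fun j => M 0 j.succ with hb
    set c : Fin n → D := fun i => M i.succ 0 with hc
    set M' := M.submatrix Fin.succ Fin.succ with hM'
    set E := matStar M' with hE
    set g := RDioid.star (M 0 0 + b ⬝ᵥ E.mulVec c) with hg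
    have ihE : ∀ i j, (1 : Matrix (Fin n) (Fin n) D) i j + ∑ l, M' i l * E l j ≤ E i j :=
      fun i j => by simpa only [Matrix.add_apply, Matrix.mul_apply] using
        Matrix.le_iff_apply.1 (ih M') i j
    have hg' := RDioid.one_add_mul_star_le (M 0 0 + b ⬝ᵥ E.mulVec c)
    rw [← hg] at hg'
    -- The column `E c` absorbs `c + M' E c`: this is the inductive unfolding of `E` applied to `c`.
    -- All lower-block estimates come from it.
    have hEc : ∀ i, c i + ∑ l, M' i l * E.mulVec c l ≤ E.mulVec c i := fun i => by
      have h1 : ∑ l, M' i l * E.mulVec c l = (M' * E).mulVec c i := by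
        rw [← Matrix.mulVec_mulVec]; rfl
      have h2 : c i + (M' * E).mulVec c i = (1 + M' * E).mulVec c i := by
        rw [Matrix.add_mulVec, Matrix.one_mulVec]; rfl
      rw [h1, h2]
      exact Finset.sum_le_sum (s := Finset.univ) fun l _ =>
        mul_le_mul' (Matrix.le_iff_apply.1 (ih M') i l) le_rfl
    have e00 : matStar M 0 0 = g := rfl
    have e0s : ∀ j : Fin n, matStar M 0 j.succ = g * E.vecMul b j := fun _ => rfl
    have es0 : ∀ i : Fin n, matStar M i.succ 0 = E.mulVec c i * g := fun _ => rfl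
    have ess : ∀ i j : Fin n, matStar M i.succ j.succ =
      E.mulVec c i * g * E.vecMul b j + E i j := fun _ _ => rfl
    have hcg : ∀ i : Fin n, c i * g + ∑ l, M' i l * (E.mulVec c l * g) ≤ E.mulVec c i * g :=
      fun i => by
        simp only [← mul_assoc, ← Finset.sum_mul, ← add_mul]
        exact mul_le_mul' (hEc i) le_rfl
    have hbg : M 0 0 * g + ∑ l, b l * (E.mulVec c l * g) =
        (M 0 0 + b ⬝ᵥ E.mulVec c) * g := by
      simp only [← mul_assoc, ← Finset.sum_mul, ← add_mul, dotProduct]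
    rw [Matrix.le_iff_apply]
    intro i j
    rw [Matrix.add_apply, Matrix.mul_apply, Fin.sum_univ_succ]
    refine Fin.cases ?_ (fun i => ?_) i <;> refine Fin.cases ?_ (fun j => ?_) j
    · simp only [e00, es0, Matrix.one_apply_eq]
      exact (congrArg (1 + ·) hbg).trans_le hg'
    · simp only [e0s, ess, Matrix.one_apply_ne (Fin.succ_ne_zero j).symm, zero_add, mul_add,
        Finset.sum_add_distrib, ← add_assoc]
      have h1 : M 0 0 * (g * E.vecMul b j) + ∑ l, b l * (E.mulVec c l * g * E.vecMul b j) =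
          ((M 0 0 + b ⬝ᵥ E.mulVec c) * g) * E.vecMul b j := by
        rw [← hbg, add_mul, Finset.sum_mul]
        simp only [mul_assoc]
      refine (congrArg (· + E.vecMul b j) h1).trans_le ?_
      calc _ = (1 + (M 0 0 + b ⬝ᵥ E.mulVec c) * g) * E.vecMul b j := by
            rw [add_mul 1, one_mul, add_comm]
        _ ≤ _ := mul_le_mul' hg' le_rfl
    · simp only [e00, es0, Matrix.one_apply_ne (Fin.succ_ne_zero i), zero_add]
      exact hcg i
    · simp only [e0s, ess, mul_add, Finset.sum_add_distrib]
      have h1 : M i.succ 0 * (g * E.vecMul b j) +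
          ∑ l : Fin n, M i.succ l.succ * (E.mulVec c l * g * E.vecMul b j) ≤
            E.mulVec c i * g * E.vecMul b j := by
        refine le_trans (le_of_eq ?_) (mul_le_mul' (hcg i) le_rfl)
        rw [add_mul, Finset.sum_mul]
        simp only [mul_assoc]
        rfl
      have h2 := ihE i j
      refine add_le ?_ (add_le ?_ (add_le ?_ ?_))
      · refine le_trans (le_trans (le_of_eq ?_) (le_self_add.trans h2)) le_add_self
        simp [Matrix.one_apply]
      · exact (le_self_add.trans h1).trans le_self_add
      · exact (le_add_self.trans h1).trans le_self_add
      · exact (le_add_self.trans h2).trans le_add_self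

/-- Square matrices over an `ℛ`-dioid form a Kleene algebra with `matStar` as iteration. -/
noncomputable instance Matrix.instKleeneAlgebraFin (n : ℕ) :
    KleeneAlgebra (Matrix (Fin n) (Fin n) D) where
  __ := Matrix.instIdemSemiringFin n
  kstar := matStar
  one_le_kstar M := le_self_add.trans (one_add_mul_matStar_le M)
  mul_kstar_le_kstar M := le_add_self.trans (one_add_mul_matStar_le M)
  -- Only the left unfolding was computed from the recursion. The right unfolding and both induction
  -- rules are checked on powers and passed to the star by `matStar_apply_le`.
  kstar_mul_le_kstar M := by
    have hpow : ∀ k : ℕ, M ^ k ≤ matStar M := fun k => by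
      induction k with
      | zero => rw [pow_zero]; exact le_self_add.trans (one_add_mul_matStar_le M)
      | succ k ih =>
        rw [pow_succ']
        exact (mul_le_mul' le_rfl ih).trans (le_add_self.trans (one_add_mul_matStar_le M))
    refine Matrix.le_iff_apply.2 fun i j => Matrix.mul_apply_le_iff.2 fun l => ?_
    have h := matStar_apply_le (M := M) (i := i) (j := l) (a := 1) (b := M l j)
      (z := matStar M i j) fun k => by
        rw [one_mul]
        refine (Matrix.mul_le_mul_apply (M ^ k) M i l j).trans ?_
        rw [← pow_succ]
        exact Matrix.le_iff_apply.1 (hpow (k + 1)) i j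
    rwa [one_mul] at h
  mul_kstar_le_self M B h := by
    have hpow : ∀ k : ℕ, B * M ^ k ≤ B := fun k => by
      induction k with
      | zero => rw [pow_zero, mul_one]
      | succ k ih => rw [pow_succ, ← mul_assoc]; exact (mul_le_mul' ih le_rfl).trans h
    refine Matrix.le_iff_apply.2 fun i j => Matrix.mul_apply_le_iff.2 fun l => ?_
    have h := matStar_apply_le (M := M) (i := l) (j := j) (a := B i l) (b := 1)
      (z := B i j) fun k => by
        rw [mul_one]
        exact (Matrix.mul_le_mul_apply B (M ^ k) i l j).trans
          (Matrix.le_iff_apply.1 (hpow k) i j)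
    rwa [mul_one] at h
  kstar_mul_le_self M B h := by
    have hpow : ∀ k : ℕ, M ^ k * B ≤ B := fun k => by
      induction k with
      | zero => rw [pow_zero, one_mul]
      | succ k ih => rw [pow_succ, mul_assoc]; exact (mul_le_mul' le_rfl h).trans ih
    refine Matrix.le_iff_apply.2 fun i j => Matrix.mul_apply_le_iff.2 fun l => ?_
    have h := matStar_apply_le (M := M) (i := i) (j := l) (a := 1) (b := B l j)
      (z := B i j) fun k => by
        rw [one_mul]
        exact (Matrix.mul_le_mul_apply (M ^ k) B i l j).trans
          (Matrix.le_iff_apply.1 (hpow k) i j)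
    rwa [one_mul] at h

end StarContinuity

/-! ### Kleene algebra identities and the reduction of bracket words. -/

section KleeneIdentities

open scoped Computability

variable {α : Type*} [KleeneAlgebra α]

theorem KleeneAlgebra.kstar_mul_slide (a b : α) : (a * b)∗ * a = a * (b * a)∗ := by
  refine le_antisymm (kstar_mul_le ?_ ?_) (mul_kstar_le ?_ ?_)
  · exact le_mul_of_one_le_right' one_le_kstar
  · rw [mul_assoc, ← mul_assoc b]
    exact mul_le_mul' le_rfl mul_kstar_le_kstar
  · exact le_mul_of_one_le_left' one_le_kstar
  · rw [← mul_assoc, mul_assoc _ a b]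
    exact mul_le_mul' kstar_mul_le_kstar le_rfl

theorem KleeneAlgebra.kstar_add_denest (a b : α) : (a + b)∗ = a∗ * (b * a∗)∗ := by
  have ha : a∗ ≤ (a + b)∗ := kstar_mono le_self_add
  have hb : b ≤ (a + b)∗ := le_add_self.trans le_kstar
  refine le_antisymm (kstar_le_of_mul_le_right ?_ ?_) ?_
  · exact one_le_mul one_le_kstar one_le_kstar
  · rw [add_mul]
    refine add_le ?_ ?_
    · rw [← mul_assoc]
      exact mul_le_mul' mul_kstar_le_kstar le_rfl
    · rw [← mul_assoc]
      exact mul_kstar_le_kstar.trans (le_mul_of_one_le_left' one_le_kstar)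
  · refine mul_kstar_le ha ?_
    calc _ ≤ (a + b)∗ * ((a + b)∗ * (a + b)∗) := by gcongr
      _ = _ := by simp only [kstar_mul_kstar]

/-- Finite approximations to the least solution of `(u * y * v + x)∗ ≤ y`. -/
def bracketApprox (u v x : α) : ℕ → α
  | 0 => 1
  | k + 1 => 1 + x + u * bracketApprox u v x k * v +
      bracketApprox u v x k * bracketApprox u v x k

variable {u v x : α}

theorem one_le_bracketApprox (k : ℕ) : 1 ≤ bracketApprox u v x k := by
  cases k with
  | zero => exact le_rfl
  | succ k =>
    exact ((le_self_add.trans le_self_add).trans le_self_add)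

theorem bracketApprox_mul_self_le (k : ℕ) :
    bracketApprox u v x k * bracketApprox u v x k ≤ bracketApprox u v x (k + 1) :=
  le_add_self

theorem mul_bracketApprox_mul_le (k : ℕ) :
    u * bracketApprox u v x k * v ≤ bracketApprox u v x (k + 1) :=
  le_add_self.trans le_self_add

theorem le_bracketApprox_succ (k : ℕ) : x ≤ bracketApprox u v x (k + 1) :=
  (le_add_self.trans le_self_add).trans le_self_add

theorem bracketApprox_le_succ (k : ℕ) : bracketApprox u v x k ≤ bracketApprox u v x (k + 1) :=
  (le_mul_of_one_le_left' (one_le_bracketApprox k)).trans (bracketApprox_mul_self_le k)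

theorem bracketApprox_le {z : α} (h1 : 1 ≤ z) (hx : x ≤ z) (hu : u * z * v ≤ z) (hz : z * z ≤ z)
    (k : ℕ) : bracketApprox u v x k ≤ z := by
  induction k with
  | zero => exact h1
  | succ k ih =>
    refine add_le (add_le (add_le h1 hx) ?_) ((mul_le_mul' ih ih).trans hz)
    exact (mul_le_mul' (mul_le_mul' le_rfl ih) le_rfl).trans hu

/-- Every word in `u`, `x`, `v` reduces to closing brackets followed by opening brackets. -/
theorem pow_le_bracketApprox (k : ℕ) :
    (u + x + v) ^ k ≤ (bracketApprox u v x (2 * k) * v)∗ * bracketApprox u v x (2 * k) *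
      (u * bracketApprox u v x (2 * k))∗ := by
  induction k with
  | zero =>
    rw [pow_zero]
    exact one_le_mul (one_le_mul one_le_kstar (one_le_bracketApprox _)) one_le_kstar
  | succ k ih =>
    rw [pow_succ']
    refine (mul_le_mul' le_rfl ih).trans ?_
    -- Each new letter costs two levels: one to contain `x` or `u * N * v`, and one to multiply that
    -- factor into the neighbouring `N`.
    have e : 2 * (k + 1) = 2 * k + 1 + 1 := by ring
    rw [e]
    set N := bracketApprox u v x (2 * k)
    set N' := bracketApprox u v x (2 * k + 1) with hN'
    set N'' := bracketApprox u v x (2 * k + 1 + 1)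
    have h1 : 1 ≤ N'' := one_le_bracketApprox _
    have h01 : N ≤ N' := bracketApprox_le_succ _
    have h12 : N' ≤ N'' := bracketApprox_le_succ _
    have h02 : N ≤ N'' := h01.trans h12
    have hx : x ≤ N' := le_bracketApprox_succ _
    have hu : u * N * v ≤ N' := mul_bracketApprox_mul_le _
    have hN : N' * N ≤ N'' := (mul_le_mul' le_rfl h01).trans (bracketApprox_mul_self_le _)
    have hL : (N'' * v) * (N'' * v)∗ ≤ (N'' * v)∗ := mul_kstar_le_kstar
    have hR : (u * N'') * (u * N'')∗ ≤ (u * N'')∗ := mul_kstar_le_kstar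
    have hL1 : 1 ≤ (N'' * v)∗ := one_le_kstar
    -- the common shape of the two cases in which a factor below `N'` arises
    have key : N' * ((N * v)∗ * N * (u * N)∗) ≤ (N'' * v)∗ * N'' * (u * N'')∗ := by
      -- Without a closing bracket, `N'` merges with the central `N`; otherwise it merges with the
      -- `N` in front of the first `v`.
      have hs : (N * v)∗ = 1 + N * v * (N * v)∗ := one_add_mul_kstar.symm
      rw [hs, add_mul, add_mul, one_mul, mul_add]
      refine add_le ?_ ?_
      · calc N' * (N * (u * N)∗) = 1 * (N' * N) * (u * N)∗ := by simp only [mul_assoc, one_mul]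
          _ ≤ _ := by gcongr
      · calc N' * (N * v * (N * v)∗ * N * (u * N)∗)
            = ((N' * N) * v * (N * v)∗) * N * (u * N)∗ := by simp only [mul_assoc]
          _ ≤ (N'' * v * (N'' * v)∗) * N'' * (u * N'')∗ := by gcongr
          _ ≤ _ := by gcongr
    rw [add_mul, add_mul]
    refine add_le (add_le ?_ ?_) ?_
    · have hs : (N * v)∗ = 1 + N * v * (N * v)∗ := one_add_mul_kstar.symm
      -- A new `u` either meets no closing bracket and joins the opening ones, or is matched with
      -- the first `v`, giving `u * N * v ≤ N'`.
      have e : u * ((N * v)∗ * N * (u * N)∗) =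
          u * N * (u * N)∗ + u * N * v * ((N * v)∗ * N * (u * N)∗) := by
        conv_lhs => rw [hs]
        simp only [add_mul, mul_add, one_mul, mul_assoc]
      rw [e]
      refine add_le ?_ ((mul_le_mul' hu le_rfl).trans key)
      calc u * N * (u * N)∗ ≤ u * N'' * (u * N'')∗ := by gcongr
        _ ≤ (u * N'')∗ := hR
        _ ≤ _ := le_mul_of_one_le_left' (one_le_mul hL1 h1)
    · exact (mul_le_mul' hx le_rfl).trans key
    · calc v * ((N * v)∗ * N * (u * N)∗) = 1 * v * (N * v)∗ * N * (u * N)∗ := by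
            simp only [mul_assoc, one_mul]
        _ ≤ N'' * v * (N'' * v)∗ * N'' * (u * N'')∗ := by gcongr
        _ ≤ _ := by gcongr

/-- Moving `p` and `q` inward past the approximation `N` makes `p * v` or `u * q` appear in every
term with an unmatched bracket. Only `p * N * q = N * (p * q) = N` survives. -/
theorem mul_pow_mul_le_bracketApprox {p q : α} (hpq : p * q = 1) (hpv : p * v = 0)
    (huq : u * q = 0) (k : ℕ)
    (hp : p * bracketApprox u v x (2 * k) = bracketApprox u v x (2 * k) * p)
    (hq : bracketApprox u v x (2 * k) * q = q * bracketApprox u v x (2 * k)) :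
    p * (u + x + v) ^ k * q ≤ bracketApprox u v x (2 * k) := by
  refine (mul_le_mul' (mul_le_mul' le_rfl (pow_le_bracketApprox k)) le_rfl).trans (le_of_eq ?_)
  set N := bracketApprox u v x (2 * k)
  have h1 : p * (N * v)∗ = p := by
    rw [← one_add_mul_kstar, mul_add, mul_one, ← mul_assoc, ← mul_assoc, hp, mul_assoc N, hpv,
      mul_zero, zero_mul, add_zero]
  have h2 : (u * N)∗ * q = q := by
    rw [← one_add_kstar_mul, add_mul, one_mul, mul_assoc, mul_assoc u, hq, ← mul_assoc u, huq,
      zero_mul, mul_zero, add_zero]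
  calc p * ((N * v)∗ * N * (u * N)∗) * q = (p * (N * v)∗) * N * ((u * N)∗ * q) := by
        simp only [mul_assoc]
    _ = N := by rw [h1, h2, hp, mul_assoc, hpq, mul_one]

end KleeneIdentities

/-! ### Matrices with entries in a centralizer. -/

section Centralizer

variable {D : Type*} [IdemSemiring D]

theorem Matrix.mul_apply_mem {R : Type*} [Semiring R] (Z : Subsemiring R) {l n k : ℕ}
    {A : Matrix (Fin l) (Fin n) R} {B : Matrix (Fin n) (Fin k) R} (hA : ∀ i j, A i j ∈ Z)
    (hB : ∀ i j, B i j ∈ Z) (i : Fin l) (j : Fin k) : (A * B) i j ∈ Z := by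
  rw [Matrix.mul_apply]
  exact Z.sum_mem fun r _ => Z.mul_mem (hA _ _) (hB _ _)

theorem Matrix.one_apply_mem {R : Type*} [Semiring R] (Z : Subsemiring R) {n : ℕ}
    (i j : Fin n) : (1 : Matrix (Fin n) (Fin n) R) i j ∈ Z := by
  rw [Matrix.one_apply]
  split_ifs
  exacts [Z.one_mem, Z.zero_mem]

theorem Matrix.pow_apply_mem {R : Type*} [Semiring R] (Z : Subsemiring R) {n : ℕ}
    {A : Matrix (Fin n) (Fin n) R} (hA : ∀ i j, A i j ∈ Z) (k : ℕ) (i j : Fin n) :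
    (A ^ k) i j ∈ Z := by
  induction k generalizing i j with
  | zero => rw [pow_zero]; exact Matrix.one_apply_mem Z i j
  | succ k ih => rw [pow_succ]; exact Matrix.mul_apply_mem Z ih hA i j

theorem Matrix.diagonal_const_mul_comm {R : Type*} [Semiring R] {l n : ℕ} {c : R}
    {A : Matrix (Fin l) (Fin n) R} (h : ∀ i j, c * A i j = A i j * c) :
    (Matrix.diagonal fun _ => c : Matrix (Fin l) (Fin l) R) * A =
      A * (Matrix.diagonal fun _ => c : Matrix (Fin n) (Fin n) R) := by
  ext i j
  rw [Matrix.diagonal_mul, Matrix.mul_diagonal, h]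

theorem Subsemiring.mul_comm_of_mem_centralizer {R : Type*} [Semiring R] {s : Set R} {z c : R}
    (hz : z ∈ Subsemiring.centralizer s) (hc : c ∈ s) : c * z = z * c :=
  Subsemiring.mem_centralizer_iff.1 hz c hc

/-- A centralizer is closed under the star because `c` commutes with all powers, and *-continuity
allows `c` as an outer factor on either side. -/
theorem matStar_apply_mem_centralizer [RDioid D] {s : Set D} {n : ℕ}
    {M : Matrix (Fin n) (Fin n) D} (hM : ∀ i j, M i j ∈ Subsemiring.centralizer s)
    (i j : Fin n) : matStar M i j ∈ Subsemiring.centralizer s := by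
  refine Subsemiring.mem_centralizer_iff.2 fun c hc => ?_
  have hpow : ∀ k, c * (M ^ k) i j = (M ^ k) i j * c := fun k =>
    Subsemiring.mul_comm_of_mem_centralizer (Matrix.pow_apply_mem _ hM k i j) hc
  have hle : ∀ k, (M ^ k) i j ≤ matStar M i j := fun k =>
    Matrix.le_iff_apply.1 (pow_le_kstar (a := M)) i j
  refine le_antisymm ?_ ?_
  · have h := matStar_apply_le (M := M) (i := i) (j := j) (a := c) (b := 1)
      (z := matStar M i j * c) fun k => by
        rw [mul_one, hpow]
        exact mul_le_mul' (hle k) le_rfl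
    rwa [mul_one] at h
  · have h := matStar_apply_le (M := M) (i := i) (j := j) (a := 1) (b := c)
      (z := c * matStar M i j) fun k => by
        rw [one_mul, ← hpow]
        exact mul_le_mul' le_rfl (hle k)
    rwa [one_mul] at h

end Centralizer

/-! ### The canonical maps into the tensor product and the bracket equations. -/

theorem RatSet.single_mul_single {M : Type*} [Monoid M] (x y : M) :
    RatSet.single x * RatSet.single y = RatSet.single (x * y) :=
  Subtype.ext Set.singleton_mul_singleton

namespace RTensor

variable {K C : Type*} [IdemSemiring K] [IdemSemiring C]

theorem inr_mul (a b : C) : (inr (a * b) : RTensor K C) = inr a * inr b := by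
  rw [inr, inr, inr, ← map_mul, RatSet.single_mul_single, Prod.mk_mul_mk, one_mul]

theorem inr_one : (inr 1 : RTensor K C) = 1 :=
  map_one (rconGen (TensorRel K C)).mk'

theorem inr_zero : (inr 0 : RTensor K C) = 0 := by
  rw [inr, ← map_zero (rconGen (TensorRel K C)).mk']
  refine ((RingCon.eq _).2 ?_).symm
  -- The tensor equation for `{1} × ∅`: the left side is the empty set, which is zero, and the right
  -- side is `{(1, 0)}`.
  have h := rconGen_of (TensorRel.mk ({1} : Set K) (∅ : Set C) (.singleton 1) .empty 1 0
    isLUB_singleton (bot_eq_zero (α := C) ▸ isLUB_empty))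
  have e : (show RatSet (K × C) from ⟨_, (IsRationalSet.singleton (1 : K)).prod (.empty (M := C))⟩) = 0 :=
    Subtype.ext Set.prod_empty
  exact e ▸ h

theorem inr_mul_inl (a : K) (b : C) : (inr b * inl a : RTensor K C) = inl a * inr b := by
  rw [inr, inl, ← map_mul, ← map_mul, RatSet.single_mul_single, RatSet.single_mul_single]
  simp

theorem inl_mem_centralizer (a : K) :
    (inl a : RTensor K C) ∈ Subsemiring.centralizer (Set.range (inr : C → RTensor K C)) :=
  Subsemiring.mem_centralizer_iff.2 (by rintro _ ⟨b, rfl⟩; exact inr_mul_inl a b)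

end RTensor

theorem Polycyclic.p_mul_q_self {m : ℕ} (i : Fin m) : (p i * q i : Polycyclic m) = 1 := by
  rw [p, q, ← map_mul, ← map_one (rconGen (BracketRel m)).mk']
  exact (RingCon.eq _).2 (rconGen_of (.same i))

theorem Polycyclic.p_mul_q_of_ne {m : ℕ} {i j : Fin m} (h : i ≠ j) :
    (p i * q j : Polycyclic m) = 0 := by
  rw [p, q, ← map_mul, ← map_zero (rconGen (BracketRel m)).mk']
  exact (RingCon.eq _).2 (rconGen_of (.diff i j h))

/-! ### Bracketing preserves the centralizer of `C_m'`. -/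

section Brackets

open scoped Computability

variable {K : Type*} [IdemSemiring K] {m n : ℕ}

/-- The centralizer of `C_m'` in `K ⊗ C_m'`. -/
abbrev RTensor.bracketCentralizer (K : Type*) [IdemSemiring K] (m : ℕ) :
    Subsemiring (RTensor K (Polycyclic m)) :=
  Subsemiring.centralizer (Set.range (RTensor.inr : Polycyclic m → RTensor K (Polycyclic m)))

theorem RTensor.inr_p_mul_mul_inr_q_mem {z : RTensor K (Polycyclic m)}
    (hz : z ∈ bracketCentralizer K m) (i j : Fin m) :
    (inr (Polycyclic.p i) * z * inr (Polycyclic.q j) : RTensor K (Polycyclic m)) ∈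
      bracketCentralizer K m := by
  rw [Subsemiring.mul_comm_of_mem_centralizer hz (Set.mem_range_self _), mul_assoc, ← inr_mul]
  by_cases h : i = j
  · subst h
    rwa [Polycyclic.p_mul_q_self, inr_one, mul_one]
  · rw [Polycyclic.p_mul_q_of_ne h, inr_zero, mul_zero]
    exact Subsemiring.zero_mem _

theorem RTensor.conjugate_apply_mem {U V Y : Matrix (Fin n) (Fin n) (RTensor K (Polycyclic m))}
    (hU : ∀ i j, U i j = 0 ∨ ∃ k : Fin m, (k : ℕ) ≠ 0 ∧ U i j = inr (Polycyclic.p k))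
    (hV : ∀ i j, V i j = 0 ∨ ∃ k : Fin m, (k : ℕ) ≠ 0 ∧ V i j = inr (Polycyclic.q k))
    (hY : ∀ i j, Y i j ∈ bracketCentralizer K m) (i j : Fin n) :
    (U * Y * V) i j ∈ bracketCentralizer K m := by
  simp only [Matrix.mul_apply, Finset.sum_mul]
  refine Subsemiring.sum_mem _ fun r _ => Subsemiring.sum_mem _ fun l _ => ?_
  rcases hU i l with h | ⟨k, -, h⟩
  · rw [h, zero_mul, zero_mul]; exact Subsemiring.zero_mem _
  rcases hV r j with h' | ⟨k', -, h'⟩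
  · rw [h', mul_zero]; exact Subsemiring.zero_mem _
  rw [h, h']
  exact inr_p_mul_mul_inr_q_mem (hY l r) k k'

/-- This is why the approximations avoid the star: sums, products and `U * · * V` visibly stay in
the centralizer. -/
theorem RTensor.bracketApprox_apply_mem
    {U V X : Matrix (Fin n) (Fin n) (RTensor K (Polycyclic m))}
    (hU : ∀ i j, U i j = 0 ∨ ∃ k : Fin m, (k : ℕ) ≠ 0 ∧ U i j = inr (Polycyclic.p k))
    (hV : ∀ i j, V i j = 0 ∨ ∃ k : Fin m, (k : ℕ) ≠ 0 ∧ V i j = inr (Polycyclic.q k))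
    (hX : ∀ i j, X i j ∈ bracketCentralizer K m) (k : ℕ) (i j : Fin n) :
    bracketApprox U V X k i j ∈ bracketCentralizer K m := by
  induction k generalizing i j with
  | zero => exact Matrix.one_apply_mem _ i j
  | succ k ih =>
    exact Subsemiring.add_mem _ (Subsemiring.add_mem _ (Subsemiring.add_mem _
      (Matrix.one_apply_mem _ i j) (hX i j)) (conjugate_apply_mem hU hV ih i j))
      (Matrix.mul_apply_mem _ ih ih i j)

end Brackets

/-! ### The normal form theorem. -/

open scoped Computability in
theorem mainTheorem7 {K : Type*} [IdemSemiring K] [RDioid K] (m : ℕ) (hm : 2 ≤ m) (n : ℕ)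
    (p₀ q₀ : RTensor K (Polycyclic m))
    (hp₀ : p₀ = RTensor.inr (Polycyclic.p ⟨0, by omega⟩))
    (hq₀ : q₀ = RTensor.inr (Polycyclic.q ⟨0, by omega⟩))
    (S : Matrix (Fin 1) (Fin n) (RTensor K (Polycyclic m)))
    (F : Matrix (Fin n) (Fin 1) (RTensor K (Polycyclic m)))
    (X : Matrix (Fin n) (Fin n) K)
    (W U V : Matrix (Fin n) (Fin n) (RTensor K (Polycyclic m)))
    (hS : ∀ i j, S i j = 0 ∨ S i j = 1)
    (hF : ∀ i j, F i j = 0 ∨ F i j = 1)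
    (hW : ∀ i j, W i j = 0 ∨ W i j = 1)
    (hU : ∀ i j, U i j = 0 ∨ ∃ k : Fin m, (k : ℕ) ≠ 0 ∧ U i j = RTensor.inr (Polycyclic.p k))
    (hV : ∀ i j, V i j = 0 ∨ ∃ k : Fin m, (k : ℕ) ≠ 0 ∧ V i j = RTensor.inr (Polycyclic.q k))
    (φ : RTensor K (Polycyclic m))
    (hφ : φ = (S * matStar (U + X.map RTensor.inl + V +
      W * Matrix.diagonal fun _ => q₀ * p₀) * F :
        Matrix (Fin 1) (Fin 1) (RTensor K (Polycyclic m))) 0 0) :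
    ∃ N : Matrix (Fin n) (Fin n) (RTensor K (Polycyclic m)),
      IsLeast {y : Matrix (Fin n) (Fin n) (RTensor K (Polycyclic m)) |
        matStar (U * y * V + X.map RTensor.inl) ≤ y} N ∧
      p₀ * φ * q₀ = (S * N * matStar (W * N) * F) 0 0 ∧
      p₀ * φ * q₀ ∈ Set.centralizer
        (Set.range (RTensor.inr : Polycyclic m → RTensor K (Polycyclic m))) := by
  have hp : p₀ ∈ Set.range (RTensor.inr : Polycyclic m → RTensor K (Polycyclic m)) :=
    ⟨_, hp₀.symm⟩
  have hq : q₀ ∈ Set.range (RTensor.inr : Polycyclic m → RTensor K (Polycyclic m)) :=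
    ⟨_, hq₀.symm⟩
  have h01 : ∀ {a : RTensor K (Polycyclic m)}, a = 0 ∨ a = 1 →
      a ∈ RTensor.bracketCentralizer K m := by
    rintro a (rfl | rfl)
    exacts [Subsemiring.zero_mem _, Subsemiring.one_mem _]
  have hSm := fun i j => h01 (hS i j)
  have hFm := fun i j => h01 (hF i j)
  have hWm := fun i j => h01 (hW i j)
  have hpq₀ : p₀ * q₀ = 1 := by
    rw [hp₀, hq₀, ← RTensor.inr_mul, Polycyclic.p_mul_q_self, RTensor.inr_one]
  set Y : Matrix (Fin n) (Fin n) (RTensor K (Polycyclic m)) := X.map RTensor.inl with hY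
  have hYm : ∀ i j, Y i j ∈ RTensor.bracketCentralizer K m := fun i j =>
    RTensor.inl_mem_centralizer (X i j)
  set P : Matrix (Fin n) (Fin n) (RTensor K (Polycyclic m)) := Matrix.diagonal fun _ => p₀ with hP
  set Q : Matrix (Fin n) (Fin n) (RTensor K (Polycyclic m)) := Matrix.diagonal fun _ => q₀ with hQ
  have hPQ : P * Q = 1 := by
    rw [hP, hQ, Matrix.diagonal_mul_diagonal]
    simp only [hpq₀]
    exact Matrix.diagonal_one
  have hPV : P * V = 0 := by
    ext i j
    rw [Matrix.diagonal_mul, Matrix.zero_apply]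
    rcases hV i j with h | ⟨k, hk, h⟩
    · rw [h, mul_zero]
    · rw [h, hp₀, ← RTensor.inr_mul, Polycyclic.p_mul_q_of_ne, RTensor.inr_zero]
      exact fun e => hk (congrArg Fin.val e).symm
  have hUQ : U * Q = 0 := by
    ext i j
    rw [Matrix.mul_diagonal, Matrix.zero_apply]
    rcases hU i j with h | ⟨k, hk, h⟩
    · rw [h, zero_mul]
    · rw [h, hq₀, ← RTensor.inr_mul, Polycyclic.p_mul_q_of_ne, RTensor.inr_zero]
      exact fun e => hk (congrArg Fin.val e)
  have commP : ∀ {Z : Matrix (Fin n) (Fin n) (RTensor K (Polycyclic m))},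
      (∀ i j, Z i j ∈ RTensor.bracketCentralizer K m) → P * Z = Z * P := fun hZ =>
    Matrix.diagonal_const_mul_comm fun i j => Subsemiring.mul_comm_of_mem_centralizer (hZ i j) hp
  have commQ : ∀ {Z : Matrix (Fin n) (Fin n) (RTensor K (Polycyclic m))},
      (∀ i j, Z i j ∈ RTensor.bracketCentralizer K m) → Q * Z = Z * Q := fun hZ =>
    Matrix.diagonal_const_mul_comm fun i j => Subsemiring.mul_comm_of_mem_centralizer (hZ i j) hq
  set A : Matrix (Fin n) (Fin n) (RTensor K (Polycyclic m)) := (U + Y + V)∗ with hA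
  -- The least solution is given in closed form, so no supremum of the approximations has to be
  -- constructed.
  set N := P * A * Q with hN
  have hNapp : ∀ i j, N i j = p₀ * A i j * q₀ := fun i j => by
    rw [hN, Matrix.mul_diagonal, Matrix.diagonal_mul]
  have hAA : A * A = A := kstar_mul_kstar _
  have hUA : U ≤ A := (le_self_add.trans le_self_add).trans le_kstar
  have hYA : Y ≤ A := (le_add_self.trans le_self_add).trans le_kstar
  have hVA : V ≤ A := le_add_self.trans le_kstar
  have hBmem := RTensor.bracketApprox_apply_mem hU hV hYm
  have hpow : ∀ k, P * (U + Y + V) ^ k * Q ≤ bracketApprox U V Y (2 * k) := fun k =>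
    mul_pow_mul_le_bracketApprox hPQ hPV hUQ k (commP (hBmem _)) (commQ (hBmem _)).symm
  have hBA : ∀ k, bracketApprox U V Y k ≤ A := bracketApprox_le one_le_kstar hYA
    (by calc U * A * V ≤ A * A * A := by gcongr
          _ = A := by rw [hAA, hAA]) hAA.le
  have hfix : ∀ {Z : Matrix (Fin n) (Fin n) (RTensor K (Polycyclic m))},
      (∀ i j, Z i j ∈ RTensor.bracketCentralizer K m) → P * Z * Q = Z := fun hZ => by
    rw [commP hZ, mul_assoc, hPQ, mul_one]
  have hleN : ∀ {Z : Matrix (Fin n) (Fin n) (RTensor K (Polycyclic m))},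
      (∀ i j, Z i j ∈ RTensor.bracketCentralizer K m) → Z ≤ A → Z ≤ N := fun hZ h => by
    rw [← hfix hZ]
    exact mul_le_mul' (mul_le_mul' le_rfl h) le_rfl
  -- Together with `hBA` and `hleN`, this makes `N` the least upper bound of the approximations.
  have hsup : ∀ {Z : Matrix (Fin n) (Fin n) (RTensor K (Polycyclic m))},
      (∀ k, bracketApprox U V Y k ≤ Z) → N ≤ Z := fun {Z} h => by
    refine Matrix.le_iff_apply.2 fun i j => ?_
    rw [hNapp]
    refine matStar_apply_le fun k => ?_
    have h1 := Matrix.le_iff_apply.1 ((hpow k).trans (h _)) i j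
    rwa [Matrix.mul_diagonal, Matrix.diagonal_mul] at h1
  -- *-continuity with outer factors `c * p₀`, `q₀` and then `p₀`, `q₀ * c`: after bounding by an
  -- approximation, `c` can change sides.
  have hNm : ∀ i j, N i j ∈ RTensor.bracketCentralizer K m := fun i j => by
    refine Subsemiring.mem_centralizer_iff.2 fun c hc => ?_
    have hk : ∀ k, p₀ * ((U + Y + V) ^ k) i j * q₀ ≤ bracketApprox U V Y (2 * k) i j :=
      fun k => by
        have h1 := Matrix.le_iff_apply.1 (hpow k) i j
        rwa [Matrix.mul_diagonal, Matrix.diagonal_mul] at h1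
    have hBN : ∀ k, bracketApprox U V Y k i j ≤ N i j := fun k =>
      Matrix.le_iff_apply.1 (hleN (hBmem k) (hBA k)) i j
    have hcomm : ∀ k, c * bracketApprox U V Y k i j = bracketApprox U V Y k i j * c := fun k =>
      Subsemiring.mul_comm_of_mem_centralizer (hBmem k i j) hc
    refine le_antisymm ?_ ?_
    · have h := matStar_apply_le (M := U + Y + V) (i := i) (j := j) (a := c * p₀) (b := q₀)
        (z := N i j * c) fun k => by
          rw [mul_assoc, mul_assoc, ← mul_assoc p₀]
          exact (mul_le_mul' le_rfl (hk k)).trans ((hcomm _).trans_le (mul_le_mul' (hBN _) le_rfl))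
      rw [hNapp i j]
      rw [mul_assoc, mul_assoc, ← mul_assoc p₀, hNapp] at h
      exact h
    · have h := matStar_apply_le (M := U + Y + V) (i := i) (j := j) (a := p₀) (b := q₀ * c)
        (z := c * N i j) fun k => by
          rw [← mul_assoc]
          exact (mul_le_mul' (hk k) le_rfl).trans
            ((hcomm _).symm.trans_le (mul_le_mul' le_rfl (hBN _)))
      rw [hNapp i j]
      rw [← mul_assoc, hNapp] at h
      exact h
  have hNA : N ≤ A := hsup hBA
  have hstarNm : ∀ i j, ((W * N)∗) i j ∈ RTensor.bracketCentralizer K m :=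
    matStar_apply_mem_centralizer (Matrix.mul_apply_mem _ hWm hNm)
  have hval : p₀ * φ * q₀ = (S * N * matStar (W * N) * F) 0 0 := by
    have hPQd : (Matrix.diagonal fun _ => q₀ * p₀) = Q * P := by
      rw [hP, hQ, Matrix.diagonal_mul_diagonal]
    have hconj : P * (U + Y + V + W * (Q * P))∗ * Q = N * (W * N)∗ := by
      rw [KleeneAlgebra.kstar_add_denest, ← hA]
      -- Bringing `Q` to the front prepares the slide `(Q b)∗ Q = Q (b Q)∗` with `b = W P A`, where
      -- `b Q = W N`.
      have e : W * (Q * P) * A = Q * (W * (P * A)) := by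
        rw [← mul_assoc, ← commQ hWm]
        simp only [mul_assoc]
      rw [e, mul_assoc, mul_assoc, KleeneAlgebra.kstar_mul_slide]
      simp only [hN, mul_assoc]
    have hSP : (Matrix.diagonal fun _ => p₀ : Matrix (Fin 1) (Fin 1) (RTensor K (Polycyclic m))) * S = S * P :=
      Matrix.diagonal_const_mul_comm fun i j =>
        Subsemiring.mul_comm_of_mem_centralizer (hSm i j) hp
    have hFQ : Q * F =
        F * (Matrix.diagonal fun _ => q₀ : Matrix (Fin 1) (Fin 1) (RTensor K (Polycyclic m))) :=
      Matrix.diagonal_const_mul_comm fun i j =>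
        Subsemiring.mul_comm_of_mem_centralizer (hFm i j) hq
    have h1 : p₀ * φ * q₀ = ((Matrix.diagonal fun _ => p₀ : Matrix (Fin 1) (Fin 1) (RTensor K (Polycyclic m))) *
        (S * (U + Y + V + W * (Q * P))∗ * F) *
          (Matrix.diagonal fun _ => q₀ : Matrix (Fin 1) (Fin 1) (RTensor K (Polycyclic m)))) 0 0 := by
      rw [Matrix.mul_diagonal, Matrix.diagonal_mul, hφ, hPQd]
      rfl
    have h2 : ((Matrix.diagonal fun _ => p₀ : Matrix (Fin 1) (Fin 1) (RTensor K (Polycyclic m))) *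
        (S * (U + Y + V + W * (Q * P))∗ * F) *
          (Matrix.diagonal fun _ => q₀ : Matrix (Fin 1) (Fin 1) (RTensor K (Polycyclic m)))) =
        S * (P * (U + Y + V + W * (Q * P))∗ * Q) * F := by
      rw [Matrix.mul_assoc, Matrix.mul_assoc (S * _), ← hFQ, Matrix.mul_assoc S,
        ← Matrix.mul_assoc _ S, hSP]
      simp only [Matrix.mul_assoc]
    rw [h1, h2, hconj, ← Matrix.mul_assoc]
    rfl
  refine ⟨N, ⟨?_, fun y hy => ?_⟩, hval, ?_⟩
  · have hNN : N * N ≤ N := by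
      -- The left factor `N` commutes with `P`, so it moves inside the conjugation, where `N ≤ A`.
      calc N * N = P * (N * A) * Q := by
            conv_lhs => rw [hN, ← hN]
            rw [← mul_assoc P N, commP hNm, hN]
            simp only [mul_assoc]
        _ ≤ P * (A * A) * Q := by gcongr
        _ = N := by rw [hAA]
    have h1 : 1 ≤ N := hleN (Matrix.one_apply_mem _) one_le_kstar
    have hUV : U * N * V ≤ N := hleN (RTensor.conjugate_apply_mem hU hV hNm) <| by
      calc U * N * V ≤ A * A * A := by gcongr
        _ = A := by rw [hAA, hAA]
    exact kstar_le_of_mul_le_left h1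
      ((mul_le_mul' le_rfl (add_le hUV (hleN hYm hYA))).trans hNN)
  · have hy' : (U * y * V + Y)∗ ≤ y := hy
    -- The bound is taken to be `(U y V + Y)∗`, not `y`: the star is multiplicatively idempotent,
    -- which is not known of `y`.
    refine hsup fun k => (bracketApprox_le one_le_kstar (le_add_self.trans le_kstar) ?_
      (kstar_mul_kstar _).le k).trans hy'
    calc U * (U * y * V + Y)∗ * V ≤ U * y * V := by gcongr
      _ ≤ _ := le_self_add.trans le_kstar
  · rw [hval]
    exact Matrix.mul_apply_mem (RTensor.bracketCentralizer K m) (Matrix.mul_apply_mem _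
      (Matrix.mul_apply_mem _ hSm hNm) hstarNm) hFm 0 0
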